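/- For an integer $m$ and a rational number $n\ge 0$ with $n+m\ge 0$ (the last condition being automatic for $m\ge 0$), the equation $$\sqrt{F^2-m^2}-m\arccos(m/F)=\pi n$$ has a unique solution $F=F_{m,n}\in[|m|,\infty)$ (for $m=0$ the second term is read as $0$); for integers $m,n\ge 0$ these are the numbers that determine the EBK spectrum of the disk billiard. Then: (1) $F_{m,n}$ is transcendental for every integer $m$ and every rational $n>0$ with $n+m>0$; in particular, for every integer $m\ge 0$ and every rational $n>0$. (2) Assume Schanuel's conjecture: whenever $\alpha_1,\dots,\alpha_N\in\mathbb{C}$ are linearly independent over $\mathbb{Q}$, one has $\operatorname{trdeg}_{\mathbb{Q}}\mathbb{Q}(\alpha_1,\dots,\alpha_N,e^{\alpha_1},\dots,e^{\alpha_N})\ge N$. Then for each fixed rational $n>0$ the numbers $F_{m,n}$, $m=0,1,2,\dots$, are pairwise distinct and the set $\{F_{m,n}: m\in\mathbb{N}_0\}$ is algebraically independent over $\mathbb{Q}$. -/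

import Mathlib

/-- The function `x ↦ √(x² - m²) - m · arccos (m / x)`, considered on `|m| ≤ x`. -/
noncomputable def diskBilliardFun (m x : ℝ) : ℝ :=
  √(x ^ 2 - m ^ 2) - m * Real.arccos (m / x)

/-- `F` is the number `F_{m,n}` of the disk billiard: `|m| ≤ F` and
`√(F² - m²) - m · arccos (m / F) = π n`. -/
def IsDiskEBKNumber (m : ℤ) (n : ℚ) (F : ℝ) : Prop :=
  |(m : ℝ)| ≤ F ∧ diskBilliardFun (m : ℝ) F = Real.pi * (n : ℝ)

/-- Schanuel's conjecture: if `α₁, …, α_N ∈ ℂ` are linearly independent over `ℚ`, then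
`ℚ(α₁, …, α_N, exp α₁, …, exp α_N)` has transcendence degree at least `N` over `ℚ`. -/
def SchanuelConjecture : Prop :=
  ∀ (N : ℕ) (α : Fin N → ℂ), LinearIndependent ℚ α →
    (N : Cardinal) ≤ Algebra.trdeg ℚ
      (IntermediateField.adjoin ℚ
        (Set.range α ∪ Set.range (fun j => Complex.exp (α j))))

/-!
Write `A = √(F² - m²)` and `t = arccos (m / F)`. The defining equation of `F = F_{m,n}` says
`A = m t + π n`, while `exp (i t) = (m + i A) / F`.

*Existence and uniqueness.* The derivative of `x ↦ √(x² - m²) - m arccos (m / x)` is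
`√(x² - m²) / x > 0`, the value at `|m|` is `π max(0, -m)`, and the function is unbounded.

*Transcendence.* If `F` were algebraic, then so would be `A`, `exp (i t)` and
`exp (i A) = exp (i t) ^ m * exp (i π n)`. By the Hermite-Lindemann theorem
(`transcendental_exp`) this forces `A = 0`, hence `F = |m|`, which is excluded by `n > 0` and
`n + m > 0`. The Hermite-Lindemann theorem is deduced from Mathlib's simultaneous approximation
`LindemannWeierstrass.exp_polynomial_approx`. Given a number field `K` that is Galois over `ℚ`, a
Galois-invariant element of the group ring `ℤ[K]` with nonzero constant coefficient does not
vanish under `x ↦ exp x` (`sum_mul_exp_ne_zero_of_galois_invariant`). If `q (exp a) = 0`, such an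
element with vanishing image is `Q * Q⁻`, where `Q = ∏ σ, q([σ a])` and `Q⁻` is the image of `Q`
under `x ↦ -x`: its constant coefficient is the sum of the squares of the coefficients of `Q`.

*Algebraic independence.* Let `t_m = arccos (m / F_m)`, so that `t_0 = π / 2`, and
`T_m = A_m / m = tan t_m = t_m + π n / m` for `m ≥ 1`. If `i t_0, …, i t_{k-1}` are linearly
independent over `ℚ`, Schanuel's conjecture gives the algebraic independence of
`F_0, …, F_{k-1}`, since all `t_j` and `exp (i t_j)` are algebraic over `ℚ(F_0, …, F_{k-1})`.
By induction it suffices to see that then `t_k = ∑ r_j t_j` with rational `r_j` is impossible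
(`arccos_not_rat_combination`). If `r_j = 0` for all `j ≥ 1`, then `exp (i t_k)` and hence `F_k`
is algebraic. Otherwise fix `j ≥ 1` with `r_j ≠ 0` and let `E` be the algebraic closure in `ℂ` of
the field generated by the other `F_l`. Then `T_k = r_j T_j + b` with `b ∈ E` real, and, as
`exp (2 i t) = (1 + i T) / (1 - i T)`, the number `T_j ∉ E` satisfies an algebraic relation over
`E`, which must be an identity in `T_j`. Comparing zeros (`cayley_rigidity`) gives `b = 0` and
`r_j = ±1`; positivity gives `T_k = T_j`, so `t_k = t_j` and `π n / k = π n / j`, whence `k = j`.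
-/

/-! ### Exponential sums over a number field -/

open Polynomial in
/-- If `x` is a root of `f ∈ ℤ[X]`, then a power of the leading coefficient of `f` clears the
denominator of `g x`, for every `g ∈ ℤ[X]` of bounded degree. -/
theorem isIntegral_leadingCoeff_pow_mul_aeval {K : Type*} [Field K] {f : ℤ[X]} {x : K}
    (hx : aeval x f = 0) (g : ℤ[X]) {D : ℕ} (hg : g.natDegree ≤ D) :
    IsIntegral ℤ ((f.leadingCoeff : K) ^ D * aeval x g) := by
  have h1 : IsIntegral ℤ ((f.leadingCoeff : K) * x) := by
    simpa [zsmul_eq_mul] using isIntegral_leadingCoeff_smul f x hx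
  have h2 : IsIntegral ℤ (f.leadingCoeff : K) := by
    simpa using isIntegral_algebraMap (R := ℤ) (A := K) (x := f.leadingCoeff)
  rw [aeval_eq_sum_range, Finset.mul_sum]
  refine IsIntegral.sum _ fun i hi => ?_
  have hi' : i ≤ D := (Nat.lt_succ_iff.mp (Finset.mem_range.mp hi)).trans hg
  have : (f.leadingCoeff : K) ^ D * g.coeff i • x ^ i
      = (g.coeff i) • ((f.leadingCoeff : K) ^ (D - i) * ((f.leadingCoeff : K) * x) ^ i) := by
    rw [zsmul_eq_mul, zsmul_eq_mul, mul_pow, ← Nat.sub_add_cancel hi', pow_add]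
    simp only [Nat.add_sub_cancel]
    ring
  rw [this]
  exact ((h2.pow _).mul (h1.pow _)).smul _

open Polynomial in
theorem exists_intPolynomial_forall_aeval_eq_zero {K : Type*} [Field K] [Algebra ℚ K]
    [Algebra.IsAlgebraic ℚ K] (S : Finset K) (hS : (0 : K) ∉ S) :
    ∃ f : ℤ[X], f.eval 0 ≠ 0 ∧ ∀ x ∈ S, aeval x f = 0 := by
  have key : ∀ x : K, ∃ q : ℤ[X], x ≠ 0 → q.coeff 0 ≠ 0 ∧ aeval x q = 0 := by
    intro x
    by_cases hx : x = 0
    · exact ⟨0, fun h => absurd hx h⟩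
    · have h : IsAlgebraic ℤ x :=
        (IsFractionRing.isAlgebraic_iff ℤ ℚ K).mpr (Algebra.IsAlgebraic.isAlgebraic x)
      obtain ⟨q, hq⟩ := h.exists_nonzero_coeff_and_aeval_eq_zero
        (mem_nonZeroDivisors_of_ne_zero hx)
      exact ⟨q, fun _ => hq⟩
  choose q hq using key
  have hne : ∀ x ∈ S, x ≠ 0 := fun x hx h => hS (h ▸ hx)
  refine ⟨∏ x ∈ S, q x, ?_, fun x hx => ?_⟩
  · rw [eval_prod, Finset.prod_ne_zero_iff]
    intro x hx
    rw [← coeff_zero_eq_eval_zero]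
    exact (hq x (hne x hx)).1
  · rw [map_prod]
    exact Finset.prod_eq_zero hx (hq x (hne x hx)).2

theorem exists_int_eq_of_isIntegral_of_fixed {K : Type*} [Field K] [Algebra ℚ K]
    [FiniteDimensional ℚ K] [IsGalois ℚ K] {x : K} (hx : IsIntegral ℤ x)
    (hfix : ∀ σ : Gal(K/ℚ), σ x = x) : ∃ z : ℤ, x = z := by
  obtain ⟨r, rfl⟩ := (IsGalois.mem_range_algebraMap_iff_fixed x).mpr hfix
  have hr : IsIntegral ℤ r :=
    (isIntegral_algebraMap_iff (algebraMap ℚ K).injective).mp hx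
  obtain ⟨z, rfl⟩ := IsIntegrallyClosed.isIntegral_iff.mp hr
  exact ⟨z, by simp⟩

theorem exists_prime_gt_mul_pow_div_factorial_lt_one (C x : ℝ) (N : ℕ) :
    ∃ p : ℕ, N < p ∧ p.Prime ∧ C * (x ^ p / (p - 1).factorial) < 1 := by
  have h1 : Filter.Tendsto (fun k : ℕ => C * (x * (x ^ k / k.factorial))) Filter.atTop
      (nhds (C * (x * 0))) :=
    ((FloorSemiring.tendsto_pow_div_factorial_atTop x).const_mul x).const_mul C
  rw [mul_zero, mul_zero] at h1
  obtain ⟨k, hk⟩ := Filter.eventually_atTop.mp (h1.eventually (gt_mem_nhds zero_lt_one))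
  obtain ⟨p, hp, hprime⟩ := Nat.exists_infinite_primes (max (k + 1) (N + 1))
  refine ⟨p, by omega, hprime, ?_⟩
  have := hk (p - 1) (by omega)
  obtain ⟨j, rfl⟩ : ∃ j, p = j + 1 := ⟨p - 1, by omega⟩
  simp only [Nat.add_sub_cancel] at this ⊢
  rwa [pow_succ', mul_div_assoc]

open Polynomial in
/-- The main step of the Hermite-Lindemann theorem: a Galois-invariant integral combination of
exponentials of elements of `K` whose constant coefficient is nonzero does not vanish.

If it did, approximate all `exp (φ x)` with `x ≠ 0` by `p g(x) / n`, for a large prime `p ∤ n`.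
By Galois invariance, clearing denominators turns `∑ c x * g(x)` into a rational integer, so the
approximation produces an integer of absolute value less than one that is not divisible by `p`. -/
theorem sum_mul_exp_ne_zero_of_galois_invariant {K : Type*} [Field K] [Algebra ℚ K]
    [FiniteDimensional ℚ K] [IsGalois ℚ K] (φ : K →+* ℂ) (c : K →₀ ℤ)
    (hinv : ∀ (σ : Gal(K/ℚ)) (x : K), c (σ x) = c x) (h0 : c 0 ≠ 0) :
    (c.sum fun x k => (k : ℂ) * Complex.exp (φ x)) ≠ 0 := by
  classical
  have : CharZero K := algebraRat.charZero K
  intro hsum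
  set S := c.support.erase 0 with hS
  obtain ⟨f, hf0, hfS⟩ := exists_intPolynomial_forall_aeval_eq_zero S (Finset.notMem_erase 0 _)
  obtain ⟨M, hM⟩ := LindemannWeierstrass.exp_polynomial_approx f hf0
  set a := f.leadingCoeff with ha
  have hfne : f ≠ 0 := by rintro rfl; simp at hf0
  have ha0 : a ≠ 0 := leadingCoeff_ne_zero.mpr hfne
  set d := f.natDegree with hd
  obtain ⟨p, hpN, hp, hpsmall⟩ := exists_prime_gt_mul_pow_div_factorial_lt_one
    (∑ x ∈ S, |(c x : ℝ)|) (|(a : ℝ)| ^ d * M)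
    ((f.eval 0).natAbs + a.natAbs + (c 0).natAbs)
  obtain ⟨n, hpn, g, hgdeg, hg⟩ := hM p (by omega) hp
  -- `∑ c x * g(x)` is rational by Galois invariance; `a ^ (p * d)` makes it integral.
  obtain ⟨z, hz⟩ : ∃ z : ℤ, (a : K) ^ (p * d) * ∑ x ∈ S, (c x : K) * aeval x g = z := by
    apply exists_int_eq_of_isIntegral_of_fixed
    · rw [Finset.mul_sum]
      refine IsIntegral.sum _ fun x hx => ?_
      have := (isIntegral_leadingCoeff_pow_mul_aeval (hfS x hx) g
        (hgdeg.trans (Nat.sub_le _ _))).smul (c x)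
      rw [zsmul_eq_mul] at this
      rwa [mul_left_comm]
    · intro σ
      simp only [map_mul, map_pow, map_sum, map_intCast]
      congr 1
      refine Finset.sum_equiv σ.toEquiv (fun x => ?_) (fun x _ => ?_)
      · simp [hS, hinv σ x]
      · have : σ (aeval x g) = aeval (σ x) g := by
          simp [aeval_eq_sum_range, zsmul_eq_mul]
        rw [this, show σ.toEquiv x = σ x from rfl, hinv]
  have hzC : (a : ℂ) ^ (p * d) * ∑ x ∈ S, (c x : ℂ) * aeval (φ x) g = z := by
    have h1 := congrArg φ hz
    simp only [map_mul, map_pow, map_sum, map_intCast] at h1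
    rw [← h1]
    congr 1
    refine Finset.sum_congr rfl fun x _ => ?_
    simp [aeval_eq_sum_range, zsmul_eq_mul]
  have hsum' : (c 0 : ℂ) + ∑ x ∈ S, (c x : ℂ) * Complex.exp (φ x) = 0 := by
    rw [Finsupp.sum, ← Finset.add_sum_erase _ _ (Finsupp.mem_support_iff.mpr h0)] at hsum
    simpa using hsum
  have hkey : ((a ^ (p * d) * n * c 0 + p * z : ℤ) : ℂ)
      = -((a : ℂ) ^ (p * d) *
          ∑ x ∈ S, (c x : ℂ) * (n • Complex.exp (φ x) - p • aeval (φ x) g)) := by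
    have e1 : ∑ x ∈ S, (c x : ℂ) * (n • Complex.exp (φ x) - p • aeval (φ x) g)
        = n * (∑ x ∈ S, (c x : ℂ) * Complex.exp (φ x))
          - p * ∑ x ∈ S, (c x : ℂ) * aeval (φ x) g := by
      rw [Finset.mul_sum, Finset.mul_sum, ← Finset.sum_sub_distrib]
      refine Finset.sum_congr rfl fun x _ => ?_
      rw [zsmul_eq_mul, nsmul_eq_mul]; ring
    rw [e1, eq_neg_of_add_eq_zero_right hsum']
    push_cast
    rw [← hzC]
    ring
  have hbound : ‖((a ^ (p * d) * n * c 0 + p * z : ℤ) : ℂ)‖ < 1 := by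
    rw [hkey, norm_neg, norm_mul, norm_pow, Complex.norm_intCast]
    refine lt_of_le_of_lt ?_ hpsmall
    have e2 : ‖∑ x ∈ S, (c x : ℂ) * (n • Complex.exp (φ x) - p • aeval (φ x) g)‖
        ≤ (∑ x ∈ S, |(c x : ℝ)|) * (M ^ p / (p - 1).factorial) := by
      rw [Finset.sum_mul]
      refine (norm_sum_le _ _).trans (Finset.sum_le_sum fun x hx => ?_)
      rw [norm_mul, Complex.norm_intCast]
      refine mul_le_mul_of_nonneg_left (hg ?_) (abs_nonneg _)
      rw [mem_aroots]
      refine ⟨hfne, ?_⟩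
      have := congrArg φ (hfS x hx)
      simpa [aeval_eq_sum_range, zsmul_eq_mul] using this
    calc |(a : ℝ)| ^ (p * d) * _ ≤ |(a : ℝ)| ^ (p * d) *
          ((∑ x ∈ S, |(c x : ℝ)|) * (M ^ p / (p - 1).factorial)) := by gcongr
      _ = _ := by rw [mul_pow, ← pow_mul, mul_comm d p]; ring
  have hzero : a ^ (p * d) * n * c 0 + p * z = 0 := by
    rw [Complex.norm_intCast] at hbound
    exact Int.abs_lt_one_iff.mp (by exact_mod_cast hbound)
  have hdvd : (p : ℤ) ∣ a ^ (p * d) * n * c 0 := ⟨-z, by linarith⟩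
  have hpp : Prime (p : ℤ) := Nat.prime_iff_prime_int.mp hp
  have hsmall : ∀ k : ℤ, k ≠ 0 → k.natAbs < p → ¬ (p : ℤ) ∣ k := fun k hk hlt h =>
    absurd (Nat.le_of_dvd (Int.natAbs_pos.mpr hk) (Int.natCast_dvd.mp h)) (by omega)
  rcases hpp.dvd_or_dvd hdvd with h | h
  · rcases hpp.dvd_or_dvd h with h | h
    · exact hsmall a ha0 (by omega) (hpp.dvd_of_dvd_pow h)
    · exact hpn h
  · exact hsmall _ h0 (by omega) h

/-! ### The Hermite-Lindemann theorem -/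

theorem AddMonoidAlgebra.coeff_mapDomain_of_equiv {G : Type*} (e : G ≃ G)
    (x : AddMonoidAlgebra ℤ G) (g : G) :
    (AddMonoidAlgebra.mapDomain e x).coeff (e g) = x.coeff g := by
  rw [AddMonoidAlgebra.coeff_mapDomain, Finsupp.mapDomain_apply e.injective]

/-- The constant coefficient of the product of an element of `ℤ[G]` with its reflection is the
sum of the squares of its coefficients. -/
theorem AddMonoidAlgebra.coeff_zero_mul_mapDomain_neg {G : Type*} [AddCommGroup G]
    (x : AddMonoidAlgebra ℤ G) :
    (x * AddMonoidAlgebra.mapDomain (fun g => -g) x).coeff 0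
      = ∑ g ∈ x.coeff.support, x.coeff g ^ 2 := by
  classical
  rw [AddMonoidAlgebra.coeff_mul, Finsupp.sum]
  refine Finset.sum_congr rfl fun g hg => ?_
  have hneg : ∀ g, (AddMonoidAlgebra.mapDomain (fun g => -g) x).coeff (-g) = x.coeff g := fun g =>
    AddMonoidAlgebra.coeff_mapDomain_of_equiv (Equiv.neg G) x g
  rw [Finsupp.sum, Finset.sum_eq_single (-g)]
  · rw [if_pos (add_neg_cancel g), hneg, sq]
  · intro h _ hne
    rw [if_neg]
    intro h0
    exact hne (eq_neg_of_add_eq_zero_right h0)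
  · intro h
    rw [Finsupp.notMem_support_iff.mp h]
    simp

theorem AddMonoidAlgebra.coeff_zero_mul_mapDomain_neg_ne_zero {G : Type*} [AddCommGroup G]
    {x : AddMonoidAlgebra ℤ G} (hx : x ≠ 0) :
    (x * AddMonoidAlgebra.mapDomain (fun g => -g) x).coeff 0 ≠ 0 := by
  rw [AddMonoidAlgebra.coeff_zero_mul_mapDomain_neg]
  have hne : x.coeff.support.Nonempty := by
    rw [Finsupp.support_nonempty_iff]
    intro h
    exact hx (AddMonoidAlgebra.coeff_injective h)
  refine (Finset.sum_pos (fun g hg => ?_) hne).ne'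
  exact sq_pos_of_ne_zero (Finsupp.mem_support_iff.mp hg)

open Polynomial in
/-- For `a ≠ 0` the group element `[a]` is transcendental over `ℤ` in the group ring `ℤ[K]`, as
its powers `[k • a]` are distinct. -/
theorem AddMonoidAlgebra.aeval_single_ne_zero {K : Type*} [Field K] [CharZero K] {a : K}
    (ha : a ≠ 0) {q : ℤ[X]} (hq : q ≠ 0) :
    aeval (AddMonoidAlgebra.single a (1 : ℤ)) q ≠ 0 := by
  classical
  intro h
  apply hq
  ext k
  have h1 := congrArg (fun x : AddMonoidAlgebra ℤ K => x.coeff (k • a)) h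
  simp only [aeval_eq_sum_range, AddMonoidAlgebra.single_pow, one_pow,
    AddMonoidAlgebra.smul_single, smul_eq_mul, mul_one, AddMonoidAlgebra.coeff_sum,
    AddMonoidAlgebra.coeff_single, AddMonoidAlgebra.coeff_zero, Finsupp.coe_finsetSum,
    Finset.sum_apply, Finsupp.coe_zero, Pi.zero_apply, Finsupp.single_apply] at h1
  have h2 : ∀ j : ℕ, j • a = k • a ↔ j = k := fun j => by
    simp [nsmul_eq_mul, ha]
  simp only [h2, Finset.sum_ite_eq', Finset.mem_range] at h1
  rw [Polynomial.coeff_zero]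
  split_ifs at h1 with h3
  · exact h1
  · exact coeff_eq_zero_of_natDegree_lt (by omega)

open Polynomial in
theorem transcendental_exp_of_galois {K : Type*} [Field K] [Algebra ℚ K]
    [FiniteDimensional ℚ K] [IsGalois ℚ K] (φ : K →+* ℂ) {a : K} (ha : a ≠ 0) :
    Transcendental ℚ (Complex.exp (φ a)) := by
  classical
  have : CharZero K := algebraRat.charZero K
  intro halg
  obtain ⟨q, hq0, hq⟩ := (IsFractionRing.isAlgebraic_iff ℤ ℚ ℂ).mpr halg
  -- the evaluation `[x] ↦ exp (φ x)`
  let E : AddMonoidAlgebra ℤ K →ₐ[ℤ] ℂ := AddMonoidAlgebra.lift ℤ ℂ K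
    { toFun := fun x => Complex.exp (φ x.toAdd)
      map_one' := by simp
      map_mul' := fun x y => by simp [Complex.exp_add] }
  have hE : ∀ x, E x = x.coeff.sum fun g k => (k : ℂ) * Complex.exp (φ g) := fun x => by
    simp [E, AddMonoidAlgebra.lift_apply, zsmul_eq_mul]
  let Q : AddMonoidAlgebra ℤ K := ∏ σ : Gal(K/ℚ), aeval (AddMonoidAlgebra.single (σ a) (1 : ℤ)) q
  have hQ0 : Q ≠ 0 := Finset.prod_ne_zero_iff.mpr fun σ _ =>
    AddMonoidAlgebra.aeval_single_ne_zero (by simpa using ha) hq0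
  have hEQ : E Q = 0 := by
    rw [map_prod]
    -- The factor of the identity is mapped to `q (exp (φ a)) = 0`.
    refine Finset.prod_eq_zero (Finset.mem_univ 1) ?_
    rw [← aeval_algHom_apply]
    simpa [E] using hq
  have hQσ : ∀ σ : Gal(K/ℚ),
      AddMonoidAlgebra.mapDomainAlgHom ℤ ℤ (σ : K ≃+ K).toAddMonoidHom Q = Q := by
    intro σ
    rw [map_prod]
    refine Fintype.prod_equiv (Equiv.mulLeft σ) _ _ fun τ => ?_
    rw [← aeval_algHom_apply]
    simp
    rfl
  -- the reflection `[x] ↦ [-x]`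
  let N : AddMonoidAlgebra ℤ K →ₐ[ℤ] AddMonoidAlgebra ℤ K :=
    AddMonoidAlgebra.mapDomainAlgHom ℤ ℤ (-AddMonoidHom.id K)
  have hN : N Q = AddMonoidAlgebra.mapDomain (fun g => -g) Q := rfl
  have hNσ : ∀ σ : Gal(K/ℚ),
      AddMonoidAlgebra.mapDomainAlgHom ℤ ℤ (σ : K ≃+ K).toAddMonoidHom (N Q) = N Q := by
    intro σ
    conv_rhs => rw [← hQσ σ]
    rw [← AlgHom.comp_apply, ← AlgHom.comp_apply]
    congr 1
    ext g
    simp [N]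
  refine sum_mul_exp_ne_zero_of_galois_invariant φ (Q * N Q).coeff (fun σ x => ?_) ?_ ?_
  · have h : AddMonoidAlgebra.mapDomainAlgHom ℤ ℤ (σ : K ≃+ K).toAddMonoidHom (Q * N Q)
        = Q * N Q := by rw [map_mul, hQσ, hNσ]
    conv_lhs => rw [← h]
    exact AddMonoidAlgebra.coeff_mapDomain_of_equiv σ.toEquiv _ x
  · rw [hN]
    exact AddMonoidAlgebra.coeff_zero_mul_mapDomain_neg_ne_zero hQ0
  · rw [← hE, map_mul, hEQ, zero_mul]

/-- The Hermite-Lindemann theorem. -/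
theorem transcendental_exp {α : ℂ} (hα : IsAlgebraic ℚ α) (h0 : α ≠ 0) :
    Transcendental ℚ (Complex.exp α) := by
  let p := minpoly ℚ α
  have hsplit : (p.map (algebraMap ℚ ℂ)).Splits := IsAlgClosed.splits _
  let K := IntermediateField.adjoin ℚ (p.rootSet ℂ)
  have : p.IsSplittingField ℚ K := IntermediateField.adjoin_rootSet_isSplittingField hsplit
  have : FiniteDimensional ℚ K := Polynomial.IsSplittingField.finiteDimensional K p
  have : Normal ℚ K := Normal.of_isSplittingField p
  have : IsGalois ℚ K := ⟨⟩
  have hmem : α ∈ K := IntermediateField.subset_adjoin _ _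
    (Polynomial.mem_rootSet.mpr ⟨minpoly.ne_zero hα.isIntegral, minpoly.aeval ℚ α⟩)
  exact transcendental_exp_of_galois (algebraMap K ℂ) (a := ⟨α, hmem⟩)
    (fun h => h0 (congrArg Subtype.val h))

/-! ### Existence and uniqueness -/

theorem continuousOn_diskBilliardFun (m : ℝ) :
    ContinuousOn (diskBilliardFun m) (Set.Ici |m|) := by
  -- For `m = 0` the quotient `m / x` has a junk value at `x = |m|`, but its arccosine is multiplied
  -- by `0`.
  rcases eq_or_ne m 0 with rfl | hm
  · unfold diskBilliardFun
    simp only [zero_mul]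
    fun_prop
  · have hpos : 0 < |m| := abs_pos.mpr hm
    refine ContinuousOn.sub (by fun_prop) (continuousOn_const.mul ?_)
    refine Real.continuous_arccos.comp_continuousOn (continuousOn_const.div continuousOn_id ?_)
    intro x hx
    exact (hpos.trans_le hx).ne'

theorem hasDerivAt_diskBilliardFun {m x : ℝ} (hx : |m| < x) :
    HasDerivAt (diskBilliardFun m) (√(x ^ 2 - m ^ 2) / x) x := by
  have hx0 : 0 < x := (abs_nonneg m).trans_lt hx
  have hsq : 0 < x ^ 2 - m ^ 2 := by
    rw [sub_pos, ← sq_abs m]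
    exact pow_lt_pow_left₀ hx (abs_nonneg m) two_ne_zero
  have hlt := abs_lt.mp hx
  have h1 : HasDerivAt (fun x : ℝ => √(x ^ 2 - m ^ 2)) (2 * x / (2 * √(x ^ 2 - m ^ 2))) x := by
    have : HasDerivAt (fun x : ℝ => x ^ 2 - m ^ 2) (2 * x) x := by
      simpa using (hasDerivAt_pow 2 x).sub_const (m ^ 2)
    exact this.sqrt hsq.ne'
  have h2 : HasDerivAt (fun x : ℝ => m / x) (-m / x ^ 2) x := by
    simpa [div_eq_mul_inv] using (hasDerivAt_inv hx0.ne').const_mul m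
  have hne1 : m / x ≠ -1 := by
    rw [Ne, div_eq_iff hx0.ne']; intro h; linarith
  have hne2 : m / x ≠ 1 := by
    rw [Ne, div_eq_iff hx0.ne']; intro h; linarith
  have h3 := (Real.hasDerivAt_arccos hne1 hne2).comp x h2
  have h4 := h1.sub (h3.const_mul m)
  have hs : √(1 - (m / x) ^ 2) = √(x ^ 2 - m ^ 2) / x := by
    rw [show 1 - (m / x) ^ 2 = (x ^ 2 - m ^ 2) / x ^ 2 by field_simp,
      Real.sqrt_div hsq.le, Real.sqrt_sq hx0.le]
  refine h4.congr_deriv ?_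
  rw [hs]
  have hs0 : 0 < √(x ^ 2 - m ^ 2) := Real.sqrt_pos.mpr hsq
  have hss : √(x ^ 2 - m ^ 2) ^ 2 = x ^ 2 - m ^ 2 := Real.sq_sqrt hsq.le
  field_simp
  linarith

theorem strictMonoOn_diskBilliardFun (m : ℝ) :
    StrictMonoOn (diskBilliardFun m) (Set.Ici |m|) := by
  refine strictMonoOn_of_deriv_pos (convex_Ici _) (continuousOn_diskBilliardFun m) fun x hx => ?_
  rw [interior_Ici] at hx
  have hx' : |m| < x := hx
  rw [(hasDerivAt_diskBilliardFun hx').deriv]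
  refine div_pos (Real.sqrt_pos.mpr ?_) ((abs_nonneg m).trans_lt hx')
  rw [sub_pos, ← sq_abs m]
  exact pow_lt_pow_left₀ hx' (abs_nonneg m) two_ne_zero

theorem diskBilliardFun_abs (m : ℝ) :
    diskBilliardFun m |m| = Real.pi * max 0 (-m) := by
  unfold diskBilliardFun
  rw [sq_abs, sub_self, Real.sqrt_zero, zero_sub]
  rcases lt_trichotomy m 0 with hm | rfl | hm
  · rw [abs_of_neg hm, div_neg, div_self hm.ne, Real.arccos_neg_one, max_eq_right (by linarith)]
    ring
  · simp
  · rw [abs_of_pos hm, div_self hm.ne', Real.arccos_one, max_eq_left (by linarith)]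
    ring

theorem exists_le_diskBilliardFun (m y : ℝ) : ∃ x, |m| ≤ x ∧ y ≤ diskBilliardFun m x := by
  have hB : 0 ≤ |y| + |m| * Real.pi := by positivity
  -- At `x = |m| + B` one has `x² - m² ≥ B²`, and `B` exceeds `|y|` by the bound `|m| π` on the
  -- second term.
  refine ⟨|m| + (|y| + |m| * Real.pi), by linarith, ?_⟩
  set x := |m| + (|y| + |m| * Real.pi)
  have h1 : |y| + |m| * Real.pi ≤ √(x ^ 2 - m ^ 2) := by
    apply Real.le_sqrt_of_sq_le
    rw [← sq_abs m]
    nlinarith [abs_nonneg m]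
  have h2 : m * Real.arccos (m / x) ≤ |m| * Real.pi :=
    (mul_le_mul_of_nonneg_right (le_abs_self m) (Real.arccos_nonneg _)).trans
      (mul_le_mul_of_nonneg_left (Real.arccos_le_pi _) (abs_nonneg m))
  unfold diskBilliardFun
  linarith [le_abs_self y]

theorem existsUnique_isDiskEBKNumber (m : ℤ) (n : ℚ) (hn : 0 ≤ n) (hnm : 0 ≤ n + (m : ℚ)) :
    ∃! F : ℝ, IsDiskEBKNumber m n F := by
  obtain ⟨b, hb, hyb⟩ := exists_le_diskBilliardFun m (Real.pi * n)
  have ha : diskBilliardFun m |(m : ℝ)| ≤ Real.pi * n := by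
    rw [diskBilliardFun_abs]
    have h1 : (0 : ℝ) ≤ n := by exact_mod_cast hn
    have h2 : (0 : ℝ) ≤ n + m := by exact_mod_cast hnm
    exact mul_le_mul_of_nonneg_left (max_le h1 (by linarith)) Real.pi_pos.le
  obtain ⟨F, hF, hFeq⟩ := intermediate_value_Icc hb
    ((continuousOn_diskBilliardFun m).mono Set.Icc_subset_Ici_self) ⟨ha, hyb⟩
  refine ⟨F, ⟨hF.1, hFeq⟩, fun G hG => ?_⟩
  exact (strictMonoOn_diskBilliardFun m).injOn hG.1 hF.1 (hG.2.trans hFeq.symm)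

/-! ### Relatively algebraically closed subfields of `ℂ` -/

/-- `E` is relatively algebraically closed in `ℂ`: every complex number algebraic over `E` lies
in `E`. -/
def IntermediateField.IsAlgClosedIn (E : IntermediateField ℚ ℂ) : Prop :=
  ∀ z : ℂ, IsAlgebraic E z → z ∈ E

/-- The relative algebraic closure of `ℚ(S)` in `ℂ`, as an intermediate field of `ℂ / ℚ`. -/
noncomputable def algClosureAdjoin (S : Set ℂ) : IntermediateField ℚ ℂ :=
  (algebraicClosure (IntermediateField.adjoin ℚ S) ℂ).restrictScalars ℚ

theorem mem_algClosureAdjoin {S : Set ℂ} {z : ℂ} :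
    z ∈ algClosureAdjoin S ↔ IsAlgebraic (IntermediateField.adjoin ℚ S) z := by
  rw [algClosureAdjoin, IntermediateField.mem_restrictScalars, mem_algebraicClosure_iff]

theorem subset_algClosureAdjoin (S : Set ℂ) : S ⊆ algClosureAdjoin S := fun z hz =>
  mem_algClosureAdjoin.mpr
    (isAlgebraic_algebraMap (⟨z, IntermediateField.subset_adjoin ℚ S hz⟩ :
      IntermediateField.adjoin ℚ S))

theorem isAlgClosedIn_algClosureAdjoin (S : Set ℂ) : (algClosureAdjoin S).IsAlgClosedIn := by
  intro z hz
  rw [mem_algClosureAdjoin]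
  exact IsAlgebraic.restrictScalars (IntermediateField.adjoin ℚ S)
    (A := ℂ) (S := algebraicClosure (IntermediateField.adjoin ℚ S) ℂ) hz

theorem mem_algClosureAdjoin_empty {z : ℂ} : z ∈ algClosureAdjoin ∅ ↔ IsAlgebraic ℚ z := by
  rw [mem_algClosureAdjoin, IntermediateField.adjoin_empty]
  constructor
  · intro h
    exact IsAlgebraic.restrictScalars ℚ h
  · exact fun h => h.tower_top _

namespace IntermediateField.IsAlgClosedIn

variable {E : IntermediateField ℚ ℂ}

theorem mem_of_pow_mem (hE : E.IsAlgClosedIn) {z : ℂ} {k : ℕ} (hk : 0 < k) (hz : z ^ k ∈ E) :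
    z ∈ E :=
  hE z (IsAlgebraic.of_pow hk (isAlgebraic_algebraMap (⟨z ^ k, hz⟩ : E)))

theorem I_mem (hE : E.IsAlgClosedIn) : Complex.I ∈ E :=
  hE.mem_of_pow_mem two_pos (by rw [Complex.I_sq]; exact neg_mem (one_mem E))

theorem exp_ratCast_mul_mem (hE : E.IsAlgClosedIn) {z : ℂ} (hz : Complex.exp z ∈ E) (r : ℚ) :
    Complex.exp (r * z) ∈ E := by
  refine hE.mem_of_pow_mem r.den_pos ?_
  have : (r.den : ℂ) * (r * z) = r.num * z := by
    rw [← mul_assoc]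
    congr 1
    exact_mod_cast r.den_mul_eq_num
  rw [← Complex.exp_nat_mul, this, Complex.exp_int_mul]
  exact zpow_mem hz _

theorem exp_I_mul_pi_mul_ratCast_mem (hE : E.IsAlgClosedIn) (r : ℚ) :
    Complex.exp (Complex.I * (Real.pi * r)) ∈ E := by
  have h := hE.exp_ratCast_mul_mem (z := Real.pi * Complex.I)
    (by rw [Complex.exp_pi_mul_I]; exact neg_mem (one_mem E)) r
  convert h using 2
  ring

end IntermediateField.IsAlgClosedIn

/-! ### Transcendence -/

namespace IsDiskEBKNumber

variable {m : ℤ} {n : ℚ} {F : ℝ}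

theorem pos (h : IsDiskEBKNumber m n F) (hn : 0 < n) : 0 < F := by
  rcases ((abs_nonneg _).trans h.1).eq_or_lt with h0 | h0
  · have hm : (m : ℝ) = 0 := by
      have := h.1; rw [← h0] at this; exact abs_nonpos_iff.mp this
    have h2 := h.2
    rw [diskBilliardFun, ← h0, hm] at h2
    have : 0 < Real.pi * n := mul_pos Real.pi_pos (by exact_mod_cast hn)
    have h3 : Real.pi * (n : ℝ) = 0 := by rw [← h2]; simp
    exact absurd h3 this.ne'
  · exact h0

theorem sqrt_eq (h : IsDiskEBKNumber m n F) :
    √(F ^ 2 - (m : ℝ) ^ 2) = m * Real.arccos (m / F) + Real.pi * n := by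
  have := h.2
  rw [diskBilliardFun] at this
  linarith

theorem sq_sqrt (h : IsDiskEBKNumber m n F) :
    √(F ^ 2 - (m : ℝ) ^ 2) ^ 2 = F ^ 2 - (m : ℝ) ^ 2 := by
  apply Real.sq_sqrt
  rw [sub_nonneg, ← sq_abs (m : ℝ)]
  exact pow_le_pow_left₀ (abs_nonneg _) h.1 2

theorem cos_arccos (h : IsDiskEBKNumber m n F) (hn : 0 < n) :
    Real.cos (Real.arccos (m / F)) = m / F := by
  have hF := h.pos hn
  have := abs_le.mp h.1
  apply Real.cos_arccos
  · rw [le_div_iff₀ hF]; linarith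
  · rw [div_le_iff₀ hF]; linarith

theorem sin_arccos (h : IsDiskEBKNumber m n F) (hn : 0 < n) :
    Real.sin (Real.arccos (m / F)) = √(F ^ 2 - (m : ℝ) ^ 2) / F := by
  have hF := h.pos hn
  rw [Real.sin_arccos, show 1 - ((m : ℝ) / F) ^ 2 = (F ^ 2 - (m : ℝ) ^ 2) / F ^ 2 by field_simp,
    Real.sqrt_div' _ (sq_nonneg F), Real.sqrt_sq hF.le]

theorem exp_I_mul_arccos (h : IsDiskEBKNumber m n F) (hn : 0 < n) :
    Complex.exp (Complex.I * (Real.arccos (m / F) : ℝ))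
      = (m + Complex.I * (√(F ^ 2 - (m : ℝ) ^ 2) : ℝ)) / F := by
  rw [mul_comm, Complex.exp_mul_I, ← Complex.ofReal_cos, ← Complex.ofReal_sin, h.cos_arccos hn,
    h.sin_arccos hn]
  push_cast
  ring

theorem sqrt_mem (h : IsDiskEBKNumber m n F) {E : IntermediateField ℚ ℂ} (hE : E.IsAlgClosedIn)
    (hF : (F : ℂ) ∈ E) : ((√(F ^ 2 - (m : ℝ) ^ 2) : ℝ) : ℂ) ∈ E := by
  refine hE.mem_of_pow_mem two_pos ?_
  rw [← Complex.ofReal_pow, h.sq_sqrt]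
  push_cast
  exact sub_mem (pow_mem hF 2) (pow_mem (intCast_mem E m) 2)

theorem exp_I_mul_arccos_mem (h : IsDiskEBKNumber m n F) (hn : 0 < n)
    {E : IntermediateField ℚ ℂ} (hE : E.IsAlgClosedIn) (hF : (F : ℂ) ∈ E) :
    Complex.exp (Complex.I * (Real.arccos (m / F) : ℝ)) ∈ E := by
  rw [h.exp_I_mul_arccos hn]
  exact div_mem (add_mem (intCast_mem E m) (mul_mem hE.I_mem (h.sqrt_mem hE hF))) hF

/-- `F = |m|` would mean `n = max(0, -m)`. -/
theorem sqrt_ne_zero (h : IsDiskEBKNumber m n F) (hn : 0 < n) (hnm : 0 < n + (m : ℚ)) :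
    √(F ^ 2 - (m : ℝ) ^ 2) ≠ 0 := by
  intro h0
  have hF := h.pos hn
  have hFm : F = |(m : ℝ)| := by
    have := h.sq_sqrt
    rw [h0, zero_pow two_ne_zero, eq_comm, sub_eq_zero] at this
    rw [← abs_of_pos hF]
    exact (sq_eq_sq_iff_abs_eq_abs _ _).mp this
  have h2 := h.2
  rw [hFm, diskBilliardFun_abs] at h2
  have h3 := mul_left_cancel₀ Real.pi_ne_zero h2
  have hn' : (0 : ℝ) < n := by exact_mod_cast hn
  have hnm' : (0 : ℝ) < n + m := by exact_mod_cast hnm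
  rcases max_choice 0 (-(m : ℝ)) with h4 | h4 <;> rw [h4] at h3 <;> linarith

theorem transcendental (h : IsDiskEBKNumber m n F) (hn : 0 < n) (hnm : 0 < n + (m : ℚ)) :
    Transcendental ℚ F := by
  intro halg
  have hE := isAlgClosedIn_algClosureAdjoin ∅
  have hF : (F : ℂ) ∈ algClosureAdjoin ∅ :=
    mem_algClosureAdjoin_empty.mpr (halg.algebraMap (A := ℂ))
  have hA := mul_mem hE.I_mem (h.sqrt_mem hE hF)
  refine transcendental_exp (mem_algClosureAdjoin_empty.mp hA) ?_ ?_
  · exact mul_ne_zero Complex.I_ne_zero (by exact_mod_cast h.sqrt_ne_zero hn hnm)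
  · rw [← mem_algClosureAdjoin_empty, h.sqrt_eq]
    push_cast
    rw [mul_add, Complex.exp_add]
    refine mul_mem ?_ (hE.exp_I_mul_pi_mul_ratCast_mem n)
    rw [mul_left_comm, Complex.exp_int_mul]
    exact zpow_mem (h.exp_I_mul_arccos_mem hn hE hF) m

end IsDiskEBKNumber

/-! ### Algebraic independence and the Cayley transform -/

/-- If `M` numbers generate, up to algebraic extensions, a field of transcendence degree at
least `M`, then they are algebraically independent. -/
theorem algebraicIndependent_of_le_trdeg_adjoin {k L : Type*} [Field k] [Field L] [Algebra k L]
    {M : ℕ} {x : Fin M → L} {S : Set L}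
    (hS : ∀ s ∈ S, IsAlgebraic (IntermediateField.adjoin k (Set.range x)) s)
    (htr : (M : Cardinal) ≤ Algebra.trdeg k (IntermediateField.adjoin k S)) :
    AlgebraicIndependent k x := by
  let Ω : IntermediateField k L :=
    (algebraicClosure (IntermediateField.adjoin k (Set.range x)) L).restrictScalars k
  have hΩ : ∀ {z : L}, z ∈ Ω ↔ IsAlgebraic (IntermediateField.adjoin k (Set.range x)) z := by
    intro z
    rw [IntermediateField.mem_restrictScalars, mem_algebraicClosure_iff]
  have hx : ∀ j, x j ∈ Ω := fun j => hΩ.mpr <| isAlgebraic_algebraMap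
    (⟨x j, IntermediateField.subset_adjoin k _ ⟨j, rfl⟩⟩ :
      IntermediateField.adjoin k (Set.range x))
  let y : Fin M → Ω := fun j => ⟨x j, hx j⟩
  have hmap : (Algebra.adjoin k (Set.range y)).map Ω.val = Algebra.adjoin k (Set.range x) := by
    rw [AlgHom.map_adjoin, ← Set.range_comp]
    rfl
  have halg : Algebra.IsAlgebraic (Algebra.adjoin k (Set.range y)) Ω := by
    constructor
    intro z
    have hz : IsAlgebraic (Algebra.adjoin k (Set.range x)) (Ω.val z) :=
      IntermediateField.isAlgebraic_adjoin_iff.mp (hΩ.mp z.2)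
    let f : Algebra.adjoin k (Set.range y) →+* Algebra.adjoin k (Set.range x) :=
      RingHom.codRestrict (Ω.val.toRingHom.comp (Algebra.adjoin k (Set.range y)).val.toRingHom)
        (Algebra.adjoin k (Set.range x)) (fun w => by
          rw [← hmap]; exact ⟨w, w.2, rfl⟩)
    refine hz.of_ringHom_of_comp_eq f Ω.val ?_ Subtype.val_injective rfl
    rintro ⟨v, hv⟩
    rw [← hmap] at hv
    obtain ⟨w, hw, rfl⟩ := hv
    exact ⟨⟨w, hw⟩, rfl⟩
  have hle : IntermediateField.adjoin k S ≤ Ω :=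
    IntermediateField.adjoin_le_iff.mpr fun s hs => hΩ.mpr (hS s hs)
  have htr' : (M : Cardinal) ≤ Algebra.trdeg k Ω :=
    htr.trans (trdeg_le_of_injective (IntermediateField.inclusion hle)
      (IntermediateField.inclusion_injective hle))
  have hy := (Algebra.IsAlgebraic.isTranscendenceBasis_of_lift_le_trdeg_of_finite k y
    (by simpa using htr')).1
  exact hy.map' (f := Ω.val) Subtype.val_injective

theorem AlgebraicIndependent.notMem_algClosureAdjoin {ι : Type*} {x : ι → ℂ}
    (hx : AlgebraicIndependent ℚ x) (j : ι) : x j ∉ algClosureAdjoin (x '' {j}ᶜ) := by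
  rw [mem_algClosureAdjoin, IntermediateField.isAlgebraic_adjoin_iff]
  exact hx.transcendental_adjoin (by simp)

open Polynomial in
/-- A relation between powers of the Cayley transforms of `Y` and of `r Y + b`, with `Y`
transcendental over `E`, is an identity in `Y`, so the zero `(i - b) / r` of `1 + i (r Y + b)` has
to be the zero `i` of `1 + i Y`. For `a = 0` there is no such relation. -/
theorem IntermediateField.IsAlgClosedIn.cayley_rigidity_nat {E : IntermediateField ℚ ℂ}
    (hE : E.IsAlgClosedIn) {Y b w : ℂ} (hY : Y ∉ E) (hb : b ∈ E) (hw : w ∈ E) (hw0 : w ≠ 0)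
    {r : ℚ} (hr : r ≠ 0) {N a : ℕ} (hN : 0 < N)
    (h : (1 + Complex.I * (r * Y + b)) ^ N * (1 - Complex.I * Y) ^ a
      = w * ((1 + Complex.I * Y) ^ a * (1 - Complex.I * (r * Y + b)) ^ N)) :
    b = Complex.I * (1 - r) := by
  let i : E := ⟨Complex.I, hE.I_mem⟩
  let b' : E := ⟨b, hb⟩
  let w' : E := ⟨w, hw⟩
  let P : E[X] := (1 + C i * (C (r : E) * X + C b')) ^ N * (1 - C i * X) ^ a
    - C w' * ((1 + C i * X) ^ a * (1 - C i * (C (r : E) * X + C b')) ^ N)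
  have haeval : ∀ z : ℂ, aeval z P
      = (1 + Complex.I * (r * z + b)) ^ N * (1 - Complex.I * z) ^ a
        - w * ((1 + Complex.I * z) ^ a * (1 - Complex.I * (r * z + b)) ^ N) := by
    intro z
    simp [P, i, b', w', IntermediateField.algebraMap_apply]
  have hP : P = 0 := by
    by_contra hP
    exact hY (hE Y ⟨P, hP, by rw [haeval, h, sub_self]⟩)
  have hr' : (r : ℂ) ≠ 0 := by exact_mod_cast hr
  -- Evaluate at the root `(i - b) / r` of `1 + i (r X + b)`, where `1 - i (r X + b) = 2`.
  have hz := haeval ((Complex.I - b) / r)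
  have hz1 : (r : ℂ) * ((Complex.I - b) / r) + b = Complex.I := by
    rw [mul_div_cancel₀ _ hr']; ring
  rw [hP, map_zero, hz1, Complex.I_mul_I, add_neg_cancel, zero_pow hN.ne', zero_mul, zero_sub,
    eq_comm, neg_eq_zero, mul_eq_zero, or_iff_right hw0, mul_eq_zero,
    or_iff_left (pow_ne_zero _ (by norm_num))] at hz
  have h1 := eq_zero_of_pow_eq_zero hz
  have h2 : (Complex.I - b) / r = Complex.I := by
    linear_combination -Complex.I * h1 + (Complex.I - b) / r * Complex.I_sq
  rw [div_eq_iff hr'] at h2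
  linear_combination -h2

theorem Complex.one_add_I_mul_ofReal_ne_zero (x : ℝ) : 1 + Complex.I * x ≠ 0 := fun h => by
  simpa using congrArg Complex.re h

theorem Complex.one_sub_I_mul_ofReal_ne_zero (x : ℝ) : 1 - Complex.I * x ≠ 0 := fun h => by
  simpa using congrArg Complex.re h

/-- The two-sided version of `cayley_rigidity_nat`, with an integer exponent `a`: for `a < 0`
replace `(y, r)` by `(-y, -r)`. Since `b` and `r` are real, `b = i (1 - r)` splits into `b = 0` and
`r = 1`. -/
theorem IntermediateField.IsAlgClosedIn.cayley_rigidity {E : IntermediateField ℚ ℂ}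
    (hE : E.IsAlgClosedIn) {y b : ℝ} {w : ℂ} (hy : (y : ℂ) ∉ E) (hb : (b : ℂ) ∈ E) (hw : w ∈ E)
    (hw0 : w ≠ 0) {r : ℚ} (hr : r ≠ 0) {N : ℕ} (hN : 0 < N) {a : ℤ}
    (h : ((1 + Complex.I * (r * y + b : ℝ)) / (1 - Complex.I * (r * y + b : ℝ))) ^ N
      = w * ((1 + Complex.I * y) / (1 - Complex.I * y)) ^ a) :
    b = 0 ∧ (r = 1 ∨ r = -1) := by
  have key : ∀ {s : ℚ}, (b : ℂ) = Complex.I * (1 - s) → b = 0 ∧ s = 1 := by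
    intro s hs
    have h1 : (b : ℂ) = ((1 - s : ℝ) : ℂ) * Complex.I := by rw [hs]; push_cast; ring
    have hre := congrArg Complex.re h1
    have him := congrArg Complex.im h1
    rw [Complex.re_ofReal_mul, Complex.I_re, mul_zero, Complex.ofReal_re] at hre
    rw [Complex.im_ofReal_mul, Complex.I_im, mul_one, Complex.ofReal_im] at him
    refine ⟨hre, ?_⟩
    have : (s : ℝ) = 1 := by linarith
    exact_mod_cast this
  have hyp := Complex.one_add_I_mul_ofReal_ne_zero y
  have hym := Complex.one_sub_I_mul_ofReal_ne_zero y
  have hzm := Complex.one_sub_I_mul_ofReal_ne_zero (r * y + b)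
  obtain ⟨k, rfl | rfl⟩ := a.eq_nat_or_neg
  · rw [zpow_natCast, div_pow, div_pow, mul_div_assoc', div_eq_div_iff (pow_ne_zero _ hzm)
      (pow_ne_zero _ hym)] at h
    push_cast at h
    obtain ⟨h1, h2⟩ := key (hE.cayley_rigidity_nat hy hb hw hw0 hr hN (h.trans (by ring)))
    exact ⟨h1, Or.inl h2⟩
  · rw [zpow_neg, zpow_natCast, ← inv_pow, inv_div, div_pow, div_pow, mul_div_assoc',
      div_eq_div_iff (pow_ne_zero _ hzm) (pow_ne_zero _ hyp)] at h
    push_cast at h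
    have hy' : -(y : ℂ) ∉ E := fun hmem => hy (by simpa using neg_mem hmem)
    obtain ⟨h1, h2⟩ := key (hE.cayley_rigidity_nat (r := -r) (N := N) (a := k) hy' hb hw hw0
      (neg_ne_zero.mpr hr) hN (by
        push_cast
        rw [neg_mul_neg, mul_neg, sub_neg_eq_add, ← sub_eq_add_neg]
        exact h.trans (by ring)))
    exact ⟨h1, Or.inr (by linarith)⟩

/-! ### Algebraic independence under Schanuel's conjecture -/

namespace IsDiskEBKNumber

variable {m : ℤ} {n : ℚ} {F : ℝ}

theorem eq_pi_mul (h : IsDiskEBKNumber 0 n F) : F = Real.pi * n := by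
  have h1 := h.2
  have h2 := h.1
  rw [Int.cast_zero, abs_zero] at h2
  simpa [diskBilliardFun, Real.sqrt_sq h2] using h1

theorem pi_mem (h : IsDiskEBKNumber 0 n F) (hn : 0 < n) {E : IntermediateField ℚ ℂ}
    (hF : (F : ℂ) ∈ E) : (Real.pi : ℂ) ∈ E := by
  have hn' : (n : ℂ) ≠ 0 := by exact_mod_cast hn.ne'
  have h1 : (Real.pi : ℂ) = F / n := by
    rw [h.eq_pi_mul]; push_cast; rw [mul_div_cancel_right₀ _ hn']
  rw [h1]
  exact div_mem hF (SubfieldClass.ratCast_mem E n)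

/-- For `m ≠ 0` this is read off from `√(F² - m²) = m arccos (m / F) + π n`; for `m = 0` the
arccosine is `π / 2`. -/
theorem arccos_mem (h : IsDiskEBKNumber m n F) {E : IntermediateField ℚ ℂ}
    (hE : E.IsAlgClosedIn) (hpi : (Real.pi : ℂ) ∈ E) (hF : (F : ℂ) ∈ E) :
    ((Real.arccos (m / F) : ℝ) : ℂ) ∈ E := by
  rcases eq_or_ne m 0 with rfl | hm
  · simp only [Int.cast_zero, zero_div, Real.arccos_zero]
    push_cast
    exact div_mem hpi (ofNat_mem E 2)
  · have hm' : (m : ℂ) ≠ 0 := by exact_mod_cast hm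
    have h1 : ((Real.arccos (m / F) : ℝ) : ℂ)
        = (((√(F ^ 2 - (m : ℝ) ^ 2) : ℝ) : ℂ) - Real.pi * n) / m := by
      rw [h.sqrt_eq]; push_cast
      rw [add_sub_cancel_right, mul_div_cancel_left₀ _ hm']
    rw [h1]
    exact div_mem (sub_mem (h.sqrt_mem hE hF) (mul_mem hpi (SubfieldClass.ratCast_mem E n)))
      (intCast_mem E m)

/-- For `t = arccos (m / F)` and `T = √(F² - m²) / m = tan t`, the number `exp (2 i t)` is the
Cayley transform of `T`. -/
theorem exp_two_I_mul_arccos (h : IsDiskEBKNumber m n F) (hn : 0 < n) (hm : m ≠ 0) :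
    Complex.exp (2 * (Complex.I * (Real.arccos (m / F) : ℝ)))
      = (1 + Complex.I * (√(F ^ 2 - (m : ℝ) ^ 2) / m : ℝ))
        / (1 - Complex.I * (√(F ^ 2 - (m : ℝ) ^ 2) / m : ℝ)) := by
  have hF : (F : ℂ) ≠ 0 := by exact_mod_cast (h.pos hn).ne'
  have hm' : (m : ℂ) ≠ 0 := by exact_mod_cast hm
  have hsq : ((√(F ^ 2 - (m : ℝ) ^ 2) : ℝ) : ℂ) ^ 2 = (F : ℂ) ^ 2 - (m : ℂ) ^ 2 := by
    exact_mod_cast congrArg (Complex.ofReal) h.sq_sqrt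
  rw [eq_div_iff (Complex.one_sub_I_mul_ofReal_ne_zero _), two_mul, Complex.exp_add,
    h.exp_I_mul_arccos hn]
  push_cast
  generalize ((√(F ^ 2 - (m : ℝ) ^ 2) : ℝ) : ℂ) = A at hsq
  field_simp
  linear_combination (m + Complex.I * A) * (hsq - A ^ 2 * Complex.I_sq)

theorem mem_of_sqrt_mem (h : IsDiskEBKNumber m n F) {E : IntermediateField ℚ ℂ}
    (hE : E.IsAlgClosedIn) (hA : ((√(F ^ 2 - (m : ℝ) ^ 2) : ℝ) : ℂ) ∈ E) : (F : ℂ) ∈ E := by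
  refine hE.mem_of_pow_mem two_pos ?_
  have h1 : (F : ℂ) ^ 2 = ((√(F ^ 2 - (m : ℝ) ^ 2) : ℝ) : ℂ) ^ 2 + (m : ℂ) ^ 2 := by
    rw [← Complex.ofReal_pow (√_), h.sq_sqrt]; push_cast; ring
  rw [h1]
  exact add_mem (pow_mem hA 2) (pow_mem (intCast_mem E m) 2)

theorem mem_of_exp_mem (h : IsDiskEBKNumber m n F) (hn : 0 < n) (hm : m ≠ 0)
    {E : IntermediateField ℚ ℂ}
    (hexp : Complex.exp (Complex.I * (Real.arccos (m / F) : ℝ)) ∈ E) : (F : ℂ) ∈ E := by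
  have hcos : ((m / F : ℝ) : ℂ) = (Complex.exp (Complex.I * (Real.arccos (m / F) : ℝ))
      + (Complex.exp (Complex.I * (Real.arccos (m / F) : ℝ)))⁻¹) / 2 := by
    rw [← Complex.exp_neg]
    conv_lhs => rw [← h.cos_arccos hn]
    rw [Complex.ofReal_cos, Complex.cos]
    ring_nf
  have h1 : ((m / F : ℝ) : ℂ) ∈ E := by
    rw [hcos]
    exact div_mem (add_mem hexp (inv_mem hexp)) (ofNat_mem E 2)
  have hF : (F : ℂ) ≠ 0 := by exact_mod_cast (h.pos hn).ne'
  have hm' : (m : ℂ) ≠ 0 := by exact_mod_cast hm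
  have h2 : (F : ℂ) = m / ((m / F : ℝ) : ℂ) := by push_cast; field_simp
  rw [h2]
  exact div_mem (intCast_mem E m) h1

theorem sqrt_div_eq (h : IsDiskEBKNumber m n F) (hm : m ≠ 0) :
    √(F ^ 2 - (m : ℝ) ^ 2) / m = Real.arccos (m / F) + Real.pi * n / m := by
  have hm' : (m : ℝ) ≠ 0 := by exact_mod_cast hm
  rw [h.sqrt_eq]
  field_simp

theorem sqrt_div_pos (h : IsDiskEBKNumber m n F) (hn : 0 < n) (hm : 0 < m) :
    0 < √(F ^ 2 - (m : ℝ) ^ 2) / m := by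
  have hm' : (0 : ℝ) < m := by exact_mod_cast hm
  have hn' : (0 : ℝ) < n := by exact_mod_cast hn
  rw [h.sqrt_div_eq hm.ne']
  exact add_pos_of_nonneg_of_pos (Real.arccos_nonneg _) (div_pos (mul_pos Real.pi_pos hn') hm')

theorem arccos_eq_arctan (h : IsDiskEBKNumber m n F) (hn : 0 < n) (hm : 0 < m) :
    Real.arccos (m / F) = Real.arctan (√(F ^ 2 - (m : ℝ) ^ 2) / m) := by
  have hm' : (0 : ℝ) < m := by exact_mod_cast hm
  have hF := h.pos hn
  rw [Real.arccos_eq_arctan (div_pos hm' hF)]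
  congr 1
  rw [show 1 - ((m : ℝ) / F) ^ 2 = (F ^ 2 - (m : ℝ) ^ 2) / F ^ 2 by field_simp,
    Real.sqrt_div' _ (sq_nonneg F), Real.sqrt_sq hF.le]
  field_simp

/-- For fixed `n`, the tangent `√(F² - m²) / m` determines the angle `arccos (m / F)`, and their
difference `π n / m` determines `m`. -/
theorem index_injective {k : ℤ} {G : ℝ} (h : IsDiskEBKNumber m n F) (h' : IsDiskEBKNumber k n G)
    (hn : 0 < n) (hm : 0 < m) (hk : 0 < k)
    (heq : √(F ^ 2 - (m : ℝ) ^ 2) / m = √(G ^ 2 - (k : ℝ) ^ 2) / k) : m = k := by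
  have h1 : Real.arccos (m / F) = Real.arccos (k / G) := by
    rw [h.arccos_eq_arctan hn hm, h'.arccos_eq_arctan hn hk, heq]
  rw [h.sqrt_div_eq hm.ne', h'.sqrt_div_eq hk.ne', h1] at heq
  have hm' : (m : ℝ) ≠ 0 := by exact_mod_cast hm.ne'
  have hk' : (k : ℝ) ≠ 0 := by exact_mod_cast hk.ne'
  have hn' : Real.pi * n ≠ 0 := mul_ne_zero Real.pi_ne_zero (by exact_mod_cast hn.ne')
  have h2 := add_left_cancel heq
  rw [div_eq_div_iff hm' hk'] at h2
  have h3 := mul_left_cancel₀ hn' h2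
  exact_mod_cast h3.symm

end IsDiskEBKNumber

section Schanuel

variable {n : ℚ} {F : ℕ → ℝ}

/-- Schanuel's conjecture for the numbers `i arccos (j / F_j)`, all of which are, together with
their exponentials, algebraic over the field generated by the `F_j`. -/
theorem algebraicIndependent_of_linearIndependent_arccos (hS : SchanuelConjecture)
    (hn : 0 < n) (h : ∀ m : ℕ, IsDiskEBKNumber (m : ℤ) n (F m)) {M : ℕ}
    (hli : LinearIndependent ℚ
      fun j : Fin M => Complex.I * (Real.arccos (((j : ℕ) : ℤ) / F j) : ℝ)) :
    AlgebraicIndependent ℚ fun j : Fin M => (F j : ℂ) := by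
  refine algebraicIndependent_of_le_trdeg_adjoin (fun s hs => ?_) (hS M _ hli)
  rw [← mem_algClosureAdjoin]
  have hE := isAlgClosedIn_algClosureAdjoin (Set.range fun j : Fin M => (F j : ℂ))
  have hF : ∀ j : Fin M,
      (F j : ℂ) ∈ algClosureAdjoin (Set.range fun j : Fin M => (F j : ℂ)) := fun j =>
    subset_algClosureAdjoin _ ⟨j, rfl⟩
  rcases hs with ⟨j, rfl⟩ | ⟨j, rfl⟩
  · have hpi := IsDiskEBKNumber.pi_mem (h 0) hn (hF ⟨0, j.pos⟩)
    exact mul_mem hE.I_mem ((h j).arccos_mem hE hpi (hF j))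
  · exact (h j).exp_I_mul_arccos_mem hn hE (hF j)

/-- If `F_0, …, F_{k-1}` are algebraically independent, then `arccos (k / F_k)` is not a rational
linear combination of the `arccos (j / F_j)` with `j < k`. -/
theorem arccos_not_rat_combination (hn : 0 < n)
    (h : ∀ m : ℕ, IsDiskEBKNumber (m : ℤ) n (F m)) {k : ℕ}
    (hF : AlgebraicIndependent ℚ fun j : Fin k => (F j : ℂ)) (c : Fin k → ℚ) :
    ∑ j, (c j : ℝ) * Real.arccos (((j : ℕ) : ℤ) / F j) ≠ Real.arccos ((k : ℤ) / F k) := by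
  intro hsum
  rcases Nat.eq_zero_or_pos k with rfl | hk
  · simp only [Finset.univ_eq_empty, Finset.sum_empty, Nat.cast_zero, Int.cast_zero, zero_div,
      Real.arccos_zero] at hsum
    linarith [Real.pi_pos]
  set t : ℕ → ℝ := fun j => Real.arccos ((j : ℤ) / F j) with ht
  have hsumC : ∀ z : ℂ, z * (t k : ℂ) = ∑ j : Fin k, z * ((c j : ℂ) * (t j : ℂ)) := by
    intro z
    rw [← Finset.mul_sum]
    congr 1
    exact_mod_cast congrArg Complex.ofReal hsum.symm
  -- If only `t 0 = π / 2` occurs, then `exp (i t k)` is a root of unity and `F k` is algebraic.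
  by_cases hc : ∀ j : Fin k, (j : ℕ) ≠ 0 → c j = 0
  · have hE := isAlgClosedIn_algClosureAdjoin ∅
    have hexp : Complex.exp (Complex.I * (t k : ℂ)) ∈ algClosureAdjoin ∅ := by
      rw [hsumC, Complex.exp_sum]
      refine prod_mem fun j _ => ?_
      by_cases hj : (j : ℕ) = 0
      · have h0 : t j = Real.pi / 2 := by
          simp [ht, hj]
        have := hE.exp_I_mul_pi_mul_ratCast_mem (c j / 2)
        convert this using 2
        rw [h0]; push_cast; ring
      · rw [hc j hj]
        simp
    have hmem := (h k).mem_of_exp_mem hn (by exact_mod_cast hk.ne') hexp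
    refine (h k).transcendental hn (by positivity) ?_
    exact (isAlgebraic_algebraMap_iff (algebraMap ℝ ℂ).injective).mp
      (mem_algClosureAdjoin_empty.mp hmem)
  · push Not at hc
    obtain ⟨j, hj0, hcj⟩ := hc
    set E := algClosureAdjoin ((fun j : Fin k => (F j : ℂ)) '' {j}ᶜ)
    have hE : E.IsAlgClosedIn := isAlgClosedIn_algClosureAdjoin _
    have hFl : ∀ l : Fin k, l ≠ j → (F l : ℂ) ∈ E := fun l hl =>
      subset_algClosureAdjoin _ ⟨l, hl, rfl⟩
    have hFj : (F j : ℂ) ∉ E := hF.notMem_algClosureAdjoin j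
    have hpi : (Real.pi : ℂ) ∈ E := IsDiskEBKNumber.pi_mem (h 0) hn
      (hFl ⟨0, hk⟩ (fun h0 => hj0 (by rw [← h0])))
    have htl : ∀ l : Fin k, l ≠ j → (t l : ℂ) ∈ E := fun l hl =>
      (h l).arccos_mem hE hpi (hFl l hl)
    have hjZ : ((j : ℕ) : ℤ) ≠ 0 := by exact_mod_cast hj0
    have hkZ : (k : ℤ) ≠ 0 := by exact_mod_cast hk.ne'
    have hjpos : (0 : ℤ) < ((j : ℕ) : ℤ) := by positivity
    have hkpos : (0 : ℤ) < (k : ℤ) := by positivity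
    set T : ℕ → ℝ := fun l => √(F l ^ 2 - ((l : ℤ) : ℝ) ^ 2) / ((l : ℤ) : ℝ) with hT
    have hTj : (T j : ℂ) ∉ E := by
      intro hmem
      refine hFj ((h j).mem_of_sqrt_mem hE ?_)
      have h1 : ((√(F j ^ 2 - (((j : ℕ) : ℤ) : ℝ) ^ 2) : ℝ) : ℂ)
          = (T j : ℂ) * (((j : ℕ) : ℤ) : ℂ) := by
        have : (((j : ℕ) : ℤ) : ℂ) ≠ 0 := by exact_mod_cast hjZ
        simp only [hT]
        push_cast
        field_simp
      rw [h1]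
      exact mul_mem hmem (intCast_mem E _)
    set b : ℝ := ∑ l ∈ Finset.univ.erase j, (c l : ℝ) * t l + Real.pi * n / (k : ℤ)
      - c j * (Real.pi * n / ((j : ℕ) : ℤ)) with hb
    have hTk : T k = c j * T j + b := by
      have h1 : T k = t k + Real.pi * n / (k : ℤ) := (h k).sqrt_div_eq hkZ
      have h2 : T j = t j + Real.pi * n / ((j : ℕ) : ℤ) := (h j).sqrt_div_eq hjZ
      have h3 : t k = c j * t j + ∑ l ∈ Finset.univ.erase j, (c l : ℝ) * t l := by
        rw [Finset.add_sum_erase _ (fun l : Fin k => (c l : ℝ) * t l) (Finset.mem_univ j)]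
        exact hsum.symm
      rw [h1, h2, h3, hb]
      ring
    have hbE : (b : ℂ) ∈ E := by
      rw [hb]
      push_cast
      refine sub_mem (add_mem (sum_mem fun l hl => ?_) ?_) ?_
      · exact mul_mem (SubfieldClass.ratCast_mem E _) (htl l (Finset.ne_of_mem_erase hl))
      · exact div_mem (mul_mem hpi (SubfieldClass.ratCast_mem E n)) (natCast_mem E k)
      · exact mul_mem (SubfieldClass.ratCast_mem E _)
          (div_mem (mul_mem hpi (SubfieldClass.ratCast_mem E n)) (natCast_mem E j))
    set w : ℂ := ∏ l ∈ Finset.univ.erase j,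
      Complex.exp ((c l : ℂ) * (2 * (Complex.I * (t l : ℂ)))) with hw
    have hwE : w ∈ E := prod_mem fun l hl => by
      refine hE.exp_ratCast_mul_mem ?_ _
      rw [two_mul, Complex.exp_add]
      have := (h l).exp_I_mul_arccos_mem hn hE (hFl l (Finset.ne_of_mem_erase hl))
      exact mul_mem this this
    have hw0 : w ≠ 0 := Finset.prod_ne_zero_iff.mpr fun l _ => Complex.exp_ne_zero _
    have hexp : Complex.exp (2 * (Complex.I * (t k : ℂ)))
        = w * Complex.exp ((c j : ℂ) * (2 * (Complex.I * (t j : ℂ)))) := by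
      rw [← mul_assoc 2, hsumC, Complex.exp_sum, ← Finset.prod_erase_mul _ _ (Finset.mem_univ j),
        hw]
      congr 1
      · exact Finset.prod_congr rfl fun l _ => by ring_nf
      · ring_nf
    -- Raising to the power `(c j).den` makes the exponent of the Cayley transform of `T j` integral.
    have hrel : ((1 + Complex.I * (c j * T j + b : ℝ)) / (1 - Complex.I * (c j * T j + b : ℝ)))
          ^ (c j).den
        = w ^ (c j).den * ((1 + Complex.I * (T j)) / (1 - Complex.I * (T j))) ^ (c j).num := by
      rw [← hTk]
      simp only [hT]
      rw [← (h k).exp_two_I_mul_arccos hn hkZ, ← (h j).exp_two_I_mul_arccos hn hjZ,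
        ← Complex.exp_int_mul, hexp, mul_pow, ← Complex.exp_nat_mul, ← mul_assoc]
      congr 3
      exact_mod_cast (c j).den_mul_eq_num
    obtain ⟨hb0, hcj1⟩ := hE.cayley_rigidity hTj hbE (pow_mem hwE _) (pow_ne_zero _ hw0) hcj
      (c j).den_pos hrel
    have hTjpos : 0 < T j := (h j).sqrt_div_pos hn hjpos
    have hTkpos : 0 < T k := (h k).sqrt_div_pos hn hkpos
    rw [hb0, add_zero] at hTk
    rcases hcj1 with h1 | h1
    · rw [h1, Rat.cast_one, one_mul] at hTk
      have := (h k).index_injective (h j) hn hkpos hjpos hTk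
      have hlt := j.2
      omega
    -- `T k = -T j` contradicts positivity.
    · rw [h1] at hTk
      push_cast at hTk
      linarith

theorem linearIndependent_I_mul_arccos (hS : SchanuelConjecture)
    (hn : 0 < n) (h : ∀ m : ℕ, IsDiskEBKNumber (m : ℤ) n (F m)) (M : ℕ) :
    LinearIndependent ℚ
      fun j : Fin M => Complex.I * (Real.arccos (((j : ℕ) : ℤ) / F j) : ℝ) := by
  induction M with
  | zero => exact linearIndependent_empty_type
  | succ k ih =>
    rw [linearIndependent_finSucc']
    refine ⟨ih, fun hmem => ?_⟩
    obtain ⟨c, hc⟩ := (Submodule.mem_span_range_iff_exists_fun ℚ).mp hmem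
    refine arccos_not_rat_combination hn h
      (algebraicIndependent_of_linearIndependent_arccos hS hn h ih) c ?_
    have h1 : Complex.I * ((∑ j, (c j : ℝ) * Real.arccos (((j : ℕ) : ℤ) / F j) : ℝ) : ℂ)
        = Complex.I * ((Real.arccos ((k : ℤ) / F k) : ℝ) : ℂ) := by
      refine Eq.trans ?_ hc
      push_cast
      rw [Finset.mul_sum]
      refine Finset.sum_congr rfl fun j _ => ?_
      rw [Rat.smul_def, Fin.init]
      simp only [Fin.val_castSucc]
      ring
    exact_mod_cast mul_left_cancel₀ Complex.I_ne_zero h1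

theorem algebraicIndependent_diskEBKNumber (hS : SchanuelConjecture)
    (hn : 0 < n) (h : ∀ m : ℕ, IsDiskEBKNumber (m : ℤ) n (F m)) :
    AlgebraicIndependent ℚ F := by
  refine algebraicIndependent_of_finite_type fun s hs => ?_
  obtain ⟨M, hM⟩ := hs.bddAbove
  have h1 : AlgebraicIndependent ℚ fun j : Fin (M + 1) => (F j : ℂ) :=
    algebraicIndependent_of_linearIndependent_arccos hS hn h
      (linearIndependent_I_mul_arccos hS hn h (M + 1))
  have h2 : AlgebraicIndependent ℚ fun j : Fin (M + 1) => F j :=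
    ((Complex.ofRealAm.restrictScalars ℚ).algebraicIndependent_iff Complex.ofReal_injective).mp h1
  exact h2.comp (fun i : s => ⟨i, Nat.lt_succ_of_le (hM i.2)⟩) fun i j hij =>
    Subtype.ext (Fin.mk.inj_iff.mp hij)

end Schanuel

theorem theorem3 :
    -- existence and uniqueness of `F_{m,n}` (the condition `0 ≤ n + m` is automatic for `0 ≤ m`)
    (∀ (m : ℤ) (n : ℚ), 0 ≤ n → 0 ≤ n + (m : ℚ) → ∃! F : ℝ, IsDiskEBKNumber m n F) ∧
    -- transcendence
    (∀ (m : ℤ) (n : ℚ), 0 < n → 0 < n + (m : ℚ) →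
      ∀ F : ℝ, IsDiskEBKNumber m n F → Transcendental ℚ F) ∧
    -- algebraic independence for fixed `n`, conditional on Schanuel's conjecture
    (SchanuelConjecture →
      ∀ n : ℚ, 0 < n → ∀ F : ℕ → ℝ, (∀ m : ℕ, IsDiskEBKNumber (m : ℤ) n (F m)) →
        AlgebraicIndependent ℚ F) :=
  ⟨existsUnique_isDiskEBKNumber, fun _ _ hn hnm _ h => h.transcendental hn hnm,
    fun hS _ hn _ h => algebraicIndependent_diskEBKNumber hS hn h⟩
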